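/- Let $G=(V,E)$ be a finite simple graph with edge weights $w_e\ge 0$. Suppose that the maximum-weight matching $M^*$ of $G$ is unique and that the LP relaxation of weighted matching, $$\max \sum_{e\in E} w_e x_e \quad\text{s.t.}\quad \sum_{j\in N(i)} x_{ij}\le 1\ (i\in V),\quad x_e\ge 0\ (e\in E),$$ is tight: it has a unique optimal solution, and at this solution every $x_e$ is $0$ or $1$. Let the dual program be: minimize $\sum_{i} z_i$ subject to $z_i\ge 0$ $(i\in V)$ and $w_{ij}\le z_i+z_j$ for all $(i,j)\in E$. Run max-product for $p(x)\propto\prod_{i\in V}\mathbf 1_{\{\sum_{j\in N(i)}x_{ij}\le 1\}}\prod_{e\in E}e^{w_ex_e}$, $x\in\{0,1\}^E$, on the factor graph whose variables are the edges and whose factors are the nodes. All messages are initially identically $1$, and in each time slot an arbitrary subset of the messages is updated, from the current messages (all of them, in the synchronous case), by $$m_{(i,j)\to i}[x]\leftarrow e^{w_{ij}x}\,m_{j\to(i,j)}[x],\qquad m_{i\to(i,j)}[1]\leftarrow\prod_{k\in N(i)-j}m_{(k,i)\to i}[0],$$ $$m_{i\to(i,j)}[0]\leftarrow\max\Big\{\prod_{k\in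 N(i)-j}m_{(k,i)\to i}[0],\ \max_{k\in N(i)-j}m_{(k,i)\to i}[1]\prod_{l\in N(i)-j-k}m_{(l,i)\to i}[0]\Big\}.$$ The belief of $e=(i,j)$ at time $t$ is $b^t_e[x]=e^{w_ex}\,m^t_{i\to e}[x]\,m^t_{j\to e}[x]$. The computation tree $T_e(t)$ is the tree, rooted at a copy of $e$, that records the message updates on which $b_e^t$ depends: initially it is the single edge $e$. Updating $m_{i\to(i,j)}$ joins at a copy of $i$ the current branches of the messages $m_{(k,i)\to i}$, $k\in N(i)-j$; the branch of $m_{(k,i)\to i}$ is empty until that message is first updated, and from each update on it is an edge $(k,i)$ followed by the branch that $m_{k\to(k,i)}$ had just before that update. The full depth-$k$ tree $\bar T_e(k)$ is defined by letting $\bar T_e(1)$ be the single edge $e$ and obtaining $\bar T_e(k)$ from $\bar T_e(k-1)$ by adding to each leaf copies of all neighbours in $G$ except the one already present. $T_e(t)$ is full up to depth $k$ if it contains $\bar T_e(k)$. Then: 1. There are an optimal dual solution $z$ and an $\varepsilon>0$ such that $w_{ij}\le z_i+z_j-\varepsilon$ for all $(i,j)\in E\setminus M^*$. 2. For every optimal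 dual solution $z$ and every $\varepsilon>0$ with this property, max-product converges to the correct answer $M^*$ by every step $k>2w_{\max}/\varepsilon$, where $w_{\max}=\max_e w_e$: for every synchronous or asynchronous schedule, every edge $e$ and every time $t$ at which $T_e(t)$ is full up to depth $k$, we have $b_e^t[1]>b_e^t[0]$ if and only if $e\in M^*$, and $b_e^t[1]<b_e^t[0]$ if and only if $e\notin M^*$. -/

import Mathlib

noncomputable section

namespace MaxProductMatching

variable {V : Type*} [Fintype V] [DecidableEq V] (G : SimpleGraph V) [DecidableRel G.Adj]

/-! ### Weighted matching, its LP relaxation and the dual program -/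

/-- A matching: a set of edges of `G`, no two of which share a node. -/
def IsMatching (M : Finset (Sym2 V)) : Prop :=
  M ⊆ G.edgeFinset ∧ ∀ e ∈ M, ∀ f ∈ M, ∀ i : V, i ∈ e → i ∈ f → e = f

/-- `M` is the unique matching of maximum weight. -/
def IsUniqueMaxWeightMatching (w : Sym2 V → ℝ) (M : Finset (Sym2 V)) : Prop :=
  IsMatching G M ∧ ∀ M', IsMatching G M' → M' ≠ M → ∑ e ∈ M', w e < ∑ e ∈ M, w e

/-- Feasible points of the LP relaxation. -/
def LPFeasible (x : G.edgeSet → ℝ) : Prop :=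
  (∀ e, 0 ≤ x e) ∧ ∀ i : V, ∑ e ∈ Finset.univ.filter (fun e : G.edgeSet => i ∈ (e : Sym2 V)), x e ≤ 1

/-- The objective of the LP relaxation. -/
def lpValue (w : Sym2 V → ℝ) (x : G.edgeSet → ℝ) : ℝ := ∑ e : G.edgeSet, w e * x e

/-- `x` is an optimal solution of the LP relaxation. -/
def LPOptimal (w : Sym2 V → ℝ) (x : G.edgeSet → ℝ) : Prop :=
  LPFeasible G x ∧ ∀ y, LPFeasible G y → lpValue G w y ≤ lpValue G w x

/-- The LP relaxation is tight: it has a unique optimal solution, and that solution is 0/1. -/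
def LPTight (w : Sym2 V → ℝ) : Prop :=
  ∃ x, LPOptimal G w x ∧ (∀ y, LPOptimal G w y → y = x) ∧ ∀ e, x e = 0 ∨ x e = 1

/-- Feasible points of the dual (weighted vertex cover) program. -/
def DualFeasible (w : Sym2 V → ℝ) (z : V → ℝ) : Prop :=
  (∀ i, 0 ≤ z i) ∧ ∀ i j, G.Adj i j → w s(i, j) ≤ z i + z j

/-- `z` is an optimal solution of the dual program. -/
def DualOptimal (w : Sym2 V → ℝ) (z : V → ℝ) : Prop :=
  DualFeasible G w z ∧ ∀ z', DualFeasible G w z' → ∑ i, z i ≤ ∑ i, z' i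

/-- The dual constraints of all edges outside `M` have slack at least `ε`. -/
def DualGap (w : Sym2 V → ℝ) (M : Finset (Sym2 V)) (z : V → ℝ) (ε : ℝ) : Prop :=
  ∀ i j, G.Adj i j → s(i, j) ∉ M → w s(i, j) ≤ z i + z j - ε

/-- The weight of the heaviest edge (`0` if there are no edges). -/
def maxWeight (w : Sym2 V → ℝ) : ℝ := ⨆ e : G.edgeSet, w e

/-! ### Max-product on the factor graph with edges as variables and nodes as factors -/

/-- The messages present in the network at some time; only entries at adjacent `i`, `j` matter.
`toVar i j` is the message from factor `i` to variable `(i,j)`, and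
`toFac i j` is the message from variable `(i,j)` to factor `i`. -/
structure Messages (V : Type*) where
  toVar : V → V → Fin 2 → ℝ
  toFac : V → V → Fin 2 → ℝ

/-- A (synchronous or asynchronous) schedule: the messages that are updated in each time slot.
`(i, j) ∈ toVar t`: the message from factor `i` to variable `(i,j)` is updated in slot `t`;
`(i, j) ∈ toFac t`: the message from variable `(i,j)` to factor `i` is updated in slot `t`.
The full synchronous schedule is the one in which all these sets are `Set.univ`. -/
structure Schedule (V : Type*) where
  toVar : ℕ → Set (V × V)
  toFac : ℕ → Set (V × V)

/-- The nodes `k ∈ N(i) - j`. -/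
def others (i j : V) : Finset V := (G.neighborFinset i).erase j

/-- The update of the message from variable `(i,j)` to factor `i`. -/
def newToFac (w : Sym2 V → ℝ) (m : Messages V) (i j : V) : Fin 2 → ℝ :=
  ![m.toVar j i 0, Real.exp (w s(i, j)) * m.toVar j i 1]

/-- The update of the message from factor `i` to variable `(i,j)`: the maximum, over all 0/1 values
of the other variables at `i` that satisfy the constraint of `i`, of the product of their messages.
If `(i,j)` has value 1 then all others are 0; if it has value 0 then all others are 0,
or exactly one of them is 1. -/
def newToVar (m : Messages V) (i j : V) : Fin 2 → ℝ :=
  ![(others G i j).fold max (∏ k ∈ others G i j, m.toFac i k 0)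
      (fun k => m.toFac i k 1 * ∏ l ∈ (others G i j).erase k, m.toFac i l 0),
    ∏ k ∈ others G i j, m.toFac i k 0]

open Classical in
/-- The messages at time `t` under a schedule. All messages are initially constantly `1`. -/
def messages (w : Sym2 V → ℝ) (S : Schedule V) : ℕ → Messages V
  | 0 => ⟨fun _ _ _ => 1, fun _ _ _ => 1⟩
  | t + 1 =>
    { toVar := fun i j => if (i, j) ∈ S.toVar t then newToVar G (messages w S t) i j
        else (messages w S t).toVar i j
      toFac := fun i j => if (i, j) ∈ S.toFac t then newToFac w (messages w S t) i j
        else (messages w S t).toFac i j }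

/-- The belief vector of the edge `(i,j)` at time `t`. -/
def belief (w : Sym2 V → ℝ) (S : Schedule V) (t : ℕ) (i j : V) : Fin 2 → ℝ :=
  ![(messages G w S t).toVar i j 0 * (messages G w S t).toVar j i 0,
    Real.exp (w s(i, j)) * (messages G w S t).toVar i j 1 * (messages G w S t).toVar j i 1]

/-! ### Computation trees

A node of a computation tree rooted at the edge `(i,j)` is represented by the non-backtracking walk
in `G` that leads to it through the root: `[j, i]` and `[i, j]` are the two ends of the root (copies
of `i` and of `j`), and `u ++ [k]` is the child of `u` that is a copy of `k`.

A branch is the part of the tree on one side of an edge `(i,j)`, say at the end `i`, with walks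
taken from `i` on: `[]` is the copy of `i`, and `k :: l` is the node reached by going to the child
`k` and following `l` from there. -/

/-- The branches that the messages of the network have accumulated.
`toVar i j` is the branch of `m_{i → (i,j)}`: the part of the tree at the end `i` of `(i,j)`.
`toFac i j` is the branch of `m_{(i,j) → i}`: the part of the tree that hangs from `i` through the
edge `(i,j)`, as seen from `j`; it is empty as long as the message has its initial value, in which
case the edge `(i,j)` is not yet in the tree. -/
structure Branches (V : Type*) where
  toVar : V → V → Set (List V)
  toFac : V → V → Set (List V)

open Classical in
/-- The branches at time `t`. They are formed by the same updates as the messages. -/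
def branches (S : Schedule V) : ℕ → Branches V
  | 0 => ⟨fun _ _ => {[]}, fun _ _ => ∅⟩
  | t + 1 =>
    { toVar := fun i j => if (i, j) ∈ S.toVar t
        then {[]} ∪ ⋃ k ∈ others G i j, List.cons k '' (branches S t).toFac i k
        else (branches S t).toVar i j
      toFac := fun i j => if (i, j) ∈ S.toFac t then (branches S t).toVar j i
        else (branches S t).toFac i j }

/-- The tree rooted at the edge `(i,j)` with branch `A` at the end `i` and `B` at the end `j`. -/
def joinAtRoot (i j : V) (A B : Set (List V)) : Set (List V) :=
  (fun l => j :: i :: l) '' A ∪ (fun l => i :: j :: l) '' B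

/-- The set of nodes of the computation tree of the edge `(i,j)` at time `t`. -/
def compTree (S : Schedule V) (t : ℕ) (i j : V) : Set (List V) :=
  joinAtRoot i j ((branches G S t).toVar i j) ((branches G S t).toVar j i)

/-- The branch at the end `i` of `(i,j)` in the full tree of depth `k`. -/
def fullBranch : ℕ → V → V → Set (List V)
  | 0, _, _ => ∅
  | 1, _, _ => {[]}
  | k + 2, i, j => {[]} ∪ ⋃ h ∈ others G i j, List.cons h '' fullBranch (k + 1) h i

/-- The set of nodes of the full depth-`k` computation tree rooted at `(i,j)`; for `k = 1` it
consists of the root edge alone. -/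
def fullTree (k : ℕ) (i j : V) : Set (List V) :=
  joinAtRoot i j (fullBranch G k i j) (fullBranch G k j i)

/-- The computation tree of `(i,j)` at time `t` is full up to depth `k`. -/
def FullUpTo (S : Schedule V) (t : ℕ) (i j : V) (k : ℕ) : Prop :=
  fullTree G k i j ⊆ compTree G S t i j

/-- Max-product converges to the correct answer `M` by step `k`: under every schedule, once the
computation tree of an edge is full up to depth at least `k`, the belief of that edge strictly
favours `1` if and only if it is in `M`, and strictly favours `0` if and only if it is not. -/
def ConvergesToBy (w : Sym2 V → ℝ) (M : Finset (Sym2 V)) (k : ℕ) : Prop :=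
  ∀ (S : Schedule V) (t : ℕ) (i j : V), G.Adj i j → FullUpTo G S t i j k →
    (belief G w S t i j 1 > belief G w S t i j 0 ↔ s(i, j) ∈ M) ∧
    (belief G w S t i j 1 < belief G w S t i j 0 ↔ s(i, j) ∉ M)

end MaxProductMatching

end

/-! Existence of the gap. Since the LP optimum is unique, every nonzero direction feasible at the
indicator of `M` strictly loses value. The strict Farkas lemma `exists_pos_combination` turns this
into a dual solution with positive slack on each edge outside `M`; the least slack serves as `ε`
(`exists_dual_gap`).

Convergence. Messages are followed directly, without optimizing over the computation tree. The
log-ratio `a_{i→j} = log (m[0] / m[1])` of a factor-to-variable message is updated to the maximum of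
`0` and all `w_{ik} - a_{k→i}`, `k ∈ N(i) - j`, where a message still at its initial value
contributes `0` instead. It is compared with `z i`: if the branch is full to depth `d`, then
`a_{i→j} ≤ max(0, z_i + γ_d)` when the edge is in `M`, and `a_{i→j} ≥ z_i - δ_d` otherwise, with
`γ_d = max(-ε, W - ⌈d/2⌉ε)` and `δ_d = max(0, W - ⌊d/2⌋ε)`.

Each bound at depth `d` yields the other at depth `d + 1` (`logRatioBound_fold_succ`): an edge
outside `M` gains `ε` by the gap, so `γ_{d+1} = δ_d - ε`; an edge of `M` is tight, so `δ_{d+1} =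
max(0, γ_d)`. The error thus shrinks by `ε` every two levels. The belief compares `w_{ij}` with
`a_{i→j} + a_{j→i}`, and for `k > 2W/ε` one has `γ_k < 0` and `δ_k < ε/2`, which decides every edge.
-/

namespace MaxProductMatching

open Finset

/-! ### Convex separation. -/

/-- Strict form of Farkas' lemma: if every nonzero functional that is nonpositive on the family `v`
is negative at `w`, then `w` is a combination of the family with positive coefficients. -/
theorem exists_pos_combination {ι F : Type*} [Fintype ι] [NormedAddCommGroup F] [NormedSpace ℝ F]
    [FiniteDimensional ℝ F] (v : ι → F) (w : F)
    (h : ∀ f : F →L[ℝ] ℝ, f ≠ 0 → (∀ i, f (v i) ≤ 0) → f w < 0) :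
    ∃ c : ι → ℝ, (∀ i, 0 < c i) ∧ ∑ i, c i • v i = w := by
  classical
  let T : (ι → ℝ) →ₗ[ℝ] F := Fintype.linearCombination ℝ v
  have hT : ∀ c, T c = ∑ i, c i • v i := fun c => Fintype.linearCombination_apply ℝ v c
  -- A nonzero functional killing the range could be used with both signs, forcing opposite strict
  -- signs at `w`. Surjectivity makes `T` open, so the image of the open orthant is open.
  have hsurj : Function.Surjective T := by
    rw [← LinearMap.range_eq_top]
    by_contra hne
    obtain ⟨f, hf0, hf⟩ := Submodule.exists_le_ker_of_lt_top _ (lt_top_iff_ne_top.2 hne)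
    have hv : ∀ i, f (v i) = 0 := fun i => by
      have : T (Pi.single i 1) = v i := by simp [T, Fintype.linearCombination_apply_single]
      rw [← this]
      exact hf (LinearMap.mem_range_self T _)
    let g : F →L[ℝ] ℝ := LinearMap.toContinuousLinearMap f
    have hg : ∀ y, g y = f y := fun _ => rfl
    have hg0 : g ≠ 0 := fun h0 => hf0 (by ext y; simpa [hg] using congrArg (fun q => q y) h0)
    have h1 := h g hg0 (fun i => by rw [hg, hv])
    have h2 := h (-g) (neg_ne_zero.2 hg0) (fun i => by simp [hg, hv])
    simp only [neg_apply] at h2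
    linarith
  let P : Set (ι → ℝ) := Set.pi Set.univ fun _ => Set.Ioi 0
  have hP : ∀ c, c ∈ P ↔ ∀ i, 0 < c i := fun c => by simp [P]
  have hopen : IsOpen (T '' P) := by
    refine LinearMap.isOpenMap_of_finiteDimensional T hsurj _ ?_
    exact isOpen_set_pi Set.finite_univ fun _ _ => isOpen_Ioi
  have hconv : Convex ℝ (T '' P) :=
    (convex_pi fun _ _ => convex_Ioi 0).linear_image T
  by_contra hcon
  have hw : w ∉ T '' P := by
    rintro ⟨c, hc, hcw⟩
    exact hcon ⟨c, (hP c).1 hc, by rw [← hT, hcw]⟩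
  obtain ⟨f, hf⟩ := geometric_hahn_banach_open_point hconv hopen hw
  have hlt : ∀ c : ι → ℝ, (∀ i, 0 < c i) → f (T c) < f w := fun c hc => hf _ ⟨c, (hP c).2 hc, rfl⟩
  -- The image of the orthant is a cone: scaling up forces `f ≤ 0` on it, scaling down forces `0 ≤ f
  -- w`.
  have hle : ∀ c : ι → ℝ, (∀ i, 0 < c i) → f (T c) ≤ 0 := by
    intro c hc
    by_contra! hpos
    obtain ⟨n, hn⟩ := exists_nat_gt (f w / f (T c))
    rw [div_lt_iff₀ hpos] at hn
    have := hlt ((n + 1 : ℝ) • c) fun i => by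
      have := hc i
      simp only [Pi.smul_apply, smul_eq_mul]; positivity
    rw [map_smul, map_smul, smul_eq_mul] at this
    linarith
  have hfw : 0 ≤ f w := by
    have hc : ∀ s : ℝ, 0 < s → s * f (T 1) < f w := fun s hs => by
      have := hlt (s • 1) fun i => by simpa using hs
      rwa [map_smul, map_smul, smul_eq_mul] at this
    by_contra! hneg
    have h1 := hle 1 fun _ => one_pos
    have h2 := hc 1 one_pos
    have h3 : f (T 1) < 0 := by linarith
    have := hc (f w / (2 * f (T 1))) (div_pos_of_neg_of_neg hneg (by linarith))
    have h4 : f w / (2 * f (T 1)) * f (T 1) = f w / 2 := by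
      have := h3.ne
      field_simp
    linarith
  have hf0 : f ≠ 0 := by
    rintro rfl
    simpa using hlt 1 fun _ => one_pos
  -- If `f (v i)` were positive, a large `i`-th coefficient would outweigh all the others.
  refine absurd (h f hf0 fun i => ?_) (not_lt.2 hfw)
  by_contra! hpos
  have hsum := hle 1 fun _ => one_pos
  obtain ⟨n, hn⟩ := exists_nat_gt (-f (T 1) / f (v i))
  rw [div_lt_iff₀ hpos] at hn
  have := hle (1 + (n : ℝ) • Pi.single i 1) fun k => by
    have : (0 : ℝ) ≤ (Pi.single i 1 : ι → ℝ) k := by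
      by_cases hk : k = i
      · subst hk; simp
      · simp [hk]
    simp only [Pi.add_apply, Pi.one_apply, Pi.smul_apply, smul_eq_mul]
    positivity
  have hTi : T (Pi.single i 1) = v i := by simp [T, Fintype.linearCombination_apply_single]
  rw [map_add, map_smul, hTi, map_add, map_smul, smul_eq_mul] at this
  linarith

/-! ### Matchings as vertices of the relaxation. -/

variable {V : Type*} [Fintype V] [DecidableEq V] {G : SimpleGraph V} [DecidableRel G.Adj]
  {w : Sym2 V → ℝ} {M : Finset (Sym2 V)}

/-- The indicator vector of a set of edges. -/
def edgeIndicator (G : SimpleGraph V) (M : Finset (Sym2 V)) (e : G.edgeSet) : ℝ :=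
  if (e : Sym2 V) ∈ M then 1 else 0

theorem sum_endpoints (z : V → ℝ) {i j : V} (h : i ≠ j) :
    ∑ k with k ∈ s(i, j), z k = z i + z j := by
  have : ({k | k ∈ s(i, j)} : Finset V) = {i, j} := by ext k; simp
  rw [this, sum_pair h]

theorem sum_edgeSet_eq (hM : M ⊆ G.edgeFinset) (g : Sym2 V → ℝ) :
    ∑ e : G.edgeSet, (if (e : Sym2 V) ∈ M then g e else 0) = ∑ e ∈ M, g e := by
  have h1 : ∑ e : G.edgeSet, (if (e : Sym2 V) ∈ M then g e else 0)
      = ∑ e ∈ G.edgeFinset, if e ∈ M then g e else 0 := by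
    exact (sum_subtype G.edgeFinset (fun e => SimpleGraph.mem_edgeFinset)
      fun e => if e ∈ M then g e else 0).symm
  rw [h1, ← sum_filter]
  congr 1
  ext e
  simp only [mem_filter]
  exact ⟨fun h => h.2, fun h => ⟨hM h, h⟩⟩

theorem lpValue_edgeIndicator (hM : M ⊆ G.edgeFinset) :
    lpValue G w (edgeIndicator G M) = ∑ e ∈ M, w e := by
  rw [← sum_edgeSet_eq hM]
  simp [lpValue, edgeIndicator]

theorem card_incident_le_one (hM : IsMatching G M) (i : V) : #{e ∈ M | i ∈ e} ≤ 1 := by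
  rw [card_le_one]
  intro e he f hf
  rw [mem_filter] at he hf
  exact hM.2 e he.1 f hf.1 i he.2 hf.2

theorem sum_incident_edgeIndicator (hM : IsMatching G M) (i : V) :
    ∑ e ∈ univ.filter (fun e : G.edgeSet => i ∈ (e : Sym2 V)), edgeIndicator G M e = #{e ∈ M | i ∈ e} := by
  have h := sum_edgeSet_eq (G := G) hM.1 (fun e => if i ∈ e then 1 else 0)
  rw [card_eq_sum_ones, Nat.cast_sum, sum_filter, sum_filter]
  simp only [Nat.cast_one]
  rw [← h]
  refine sum_congr rfl fun e _ => ?_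
  simp only [edgeIndicator]
  split_ifs <;> rfl

theorem lpFeasible_edgeIndicator (hM : IsMatching G M) : LPFeasible G (edgeIndicator G M) := by
  refine ⟨fun e => by unfold edgeIndicator; split_ifs <;> norm_num, fun i => ?_⟩
  rw [sum_incident_edgeIndicator hM]
  exact_mod_cast card_incident_le_one hM i

/-- Double counting: a node lies on at most one edge of a matching. -/
theorem sum_matching_endpoints (hM : IsMatching G M) (z : V → ℝ) :
    ∑ e ∈ M, ∑ i with i ∈ e, z i = ∑ i with ∃ e ∈ M, i ∈ e, z i := by
  simp only [sum_filter]
  rw [sum_comm]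
  refine sum_congr rfl fun i _ => ?_
  rw [← sum_filter, sum_const, nsmul_eq_mul]
  split_ifs with h
  · obtain ⟨e, he, hi⟩ := h
    have : #{e ∈ M | i ∈ e} = 1 := le_antisymm (card_incident_le_one hM i)
      (card_pos.2 ⟨e, mem_filter.2 ⟨he, hi⟩⟩)
    simp [this]
  · push Not at h
    rw [filter_eq_empty_iff.2 fun {e} he => h e he]
    simp

/-- The unique optimal solution of a tight relaxation is the indicator of the optimal matching. -/
theorem lp_unique_edgeIndicator (hM : IsUniqueMaxWeightMatching G w M) (ht : LPTight G w) :
    ∀ y, LPFeasible G y → y ≠ edgeIndicator G M → lpValue G w y < ∑ e ∈ M, w e := by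
  obtain ⟨x, hx, huniq, h01⟩ := ht
  let M' : Finset (Sym2 V) := G.edgeFinset.filter fun e => ∃ h : e ∈ G.edgeSet, x ⟨e, h⟩ = 1
  have hxM' : x = edgeIndicator G M' := by
    funext e
    have : (e : Sym2 V) ∈ M' ↔ x e = 1 := by
      simp only [M', mem_filter, SimpleGraph.mem_edgeFinset]
      exact ⟨fun h => h.2.2, fun h => ⟨e.2, e.2, h⟩⟩
    unfold edgeIndicator
    rcases h01 e with h | h <;> simp [this, h]
  have hM' : IsMatching G M' := by
    refine ⟨filter_subset _ _, fun e he f hf i hie hif => ?_⟩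
    by_contra hne
    simp only [M', mem_filter] at he hf
    obtain ⟨-, he, hxe⟩ := he
    obtain ⟨-, hf, hxf⟩ := hf
    have hsub : ({⟨e, he⟩, ⟨f, hf⟩} : Finset G.edgeSet) ⊆ ({a | i ∈ (a : Sym2 V)} : Finset G.edgeSet) := by
      intro a ha
      rw [mem_insert, mem_singleton] at ha
      rcases ha with rfl | rfl <;> simpa
    have := (sum_le_sum_of_subset_of_nonneg hsub fun a _ _ => hx.1.1 a).trans (hx.1.2 i)
    rw [sum_pair (by simpa using hne), hxe, hxf] at this
    norm_num at this
  have hMM' : M' = M := by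
    by_contra hne
    have h1 := hM.2 M' hM' hne
    have h2 := hx.2 _ (lpFeasible_edgeIndicator hM.1)
    rw [hxM', lpValue_edgeIndicator hM.1.1, lpValue_edgeIndicator hM'.1] at h2
    linarith
  rw [hMM'] at hxM'
  intro y hy hne
  have hval : lpValue G w x = ∑ e ∈ M, w e := by rw [hxM', lpValue_edgeIndicator hM.1.1]
  refine lt_of_le_of_ne (hval ▸ hx.2 y hy) fun heq => hne ?_
  rw [← hxM']
  exact huniq y ⟨hy, fun y' hy' => by rw [heq, ← hval]; exact hx.2 y' hy'⟩

/-- Directions along which the indicator of the optimal matching can be moved inside the feasible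
region of a tight relaxation strictly decrease the objective. -/
theorem direction_value_neg (hM : IsUniqueMaxWeightMatching G w M) (ht : LPTight G w)
    (d : G.edgeSet → ℝ) (hd : d ≠ 0) (hd0 : ∀ e : G.edgeSet, (e : Sym2 V) ∉ M → 0 ≤ d e)
    (hd1 : ∀ i, (∃ e ∈ M, i ∈ e) → ∑ e ∈ univ.filter (fun e : G.edgeSet => i ∈ (e : Sym2 V)), d e ≤ 0) :
    ∑ e : G.edgeSet, w e * d e < 0 := by
  -- The step length `D⁻¹` keeps every partial sum of the displacement within `1`, the slack
  -- available on edges of `M` and at unmatched nodes.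
  let D : ℝ := 1 + ∑ e, |d e|
  have hDs : 0 ≤ ∑ e, |d e| := sum_nonneg fun e _ => abs_nonneg _
  have hD : 0 < D := by positivity
  have hDe : ∀ s : Finset G.edgeSet, |∑ e ∈ s, d e| ≤ D := fun s =>
    calc |∑ e ∈ s, d e| ≤ ∑ e ∈ s, |d e| := abs_sum_le_sum_abs _ _
      _ ≤ ∑ e, |d e| := sum_le_sum_of_subset_of_nonneg (subset_univ s) fun e _ _ => abs_nonneg _
      _ ≤ D := by simp [D]
  have hbound : ∀ s : Finset G.edgeSet, |D⁻¹ * ∑ e ∈ s, d e| ≤ 1 := fun s => by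
    rw [abs_mul, abs_of_pos (inv_pos.2 hD), inv_mul_le_iff₀ hD, mul_one]
    exact hDe s
  let y : G.edgeSet → ℝ := fun e => edgeIndicator G M e + D⁻¹ * d e
  have hy : LPFeasible G y := by
    refine ⟨fun e => ?_, fun i => ?_⟩
    · by_cases he : (e : Sym2 V) ∈ M
      · have := (abs_le.1 (hbound {e})).1
        simp only [sum_singleton] at this
        simp only [y, edgeIndicator, he, if_true]
        linarith
      · have := mul_nonneg (inv_pos.2 hD).le (hd0 e he)
        simpa [y, edgeIndicator, he] using this
    · simp only [y, sum_add_distrib, ← mul_sum]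
      by_cases hi : ∃ e ∈ M, i ∈ e
      · have h1 := (lpFeasible_edgeIndicator hM.1).2 i
        have h2 := mul_nonpos_of_nonneg_of_nonpos (inv_pos.2 hD).le (hd1 i hi)
        linarith
      · push Not at hi
        have h1 := sum_incident_edgeIndicator hM.1 i
        rw [filter_eq_empty_iff.2 fun {e} he => hi e he] at h1
        have h2 := (abs_le.1 (hbound {e | i ∈ (e : Sym2 V)})).2
        rw [h1]
        simpa using h2
  have hne : y ≠ edgeIndicator G M := by
    intro h
    refine hd (funext fun e => ?_)
    have := congrFun h e
    simpa [y, hD.ne'] using this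
  have := lp_unique_edgeIndicator hM ht y hy hne
  rw [← lpValue_edgeIndicator hM.1.1] at this
  have hv : lpValue G w y = lpValue G w (edgeIndicator G M) + D⁻¹ * ∑ e : G.edgeSet, w e * d e := by
    simp only [lpValue, y, mul_add, sum_add_distrib, mul_sum]
    congr 1
    exact sum_congr rfl fun e _ => by ring
  rw [hv] at this
  have h3 : D⁻¹ * ∑ e : G.edgeSet, w e * d e < 0 := by linarith
  exact neg_of_mul_neg_right h3 (inv_pos.2 hD).le

/-! ### Duality and complementary slackness. -/

/-- Weak duality, against the indicator of a matching. -/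
theorem weight_le_sum_dual (hM : IsMatching G M) {z : V → ℝ} (hz : DualFeasible G w z) :
    ∑ e ∈ M, w e ≤ ∑ i, z i := by
  have h1 : ∑ e ∈ M, w e ≤ ∑ e ∈ M, ∑ i with i ∈ e, z i := by
    refine sum_le_sum fun e he => ?_
    have hadj := SimpleGraph.mem_edgeFinset.1 (hM.1 he)
    induction e with | _ i j
    rw [SimpleGraph.mem_edgeSet] at hadj
    rw [sum_endpoints z hadj.ne]
    exact hz.2 i j hadj
  rw [sum_matching_endpoints hM] at h1
  exact h1.trans (sum_le_sum_of_subset_of_nonneg (subset_univ _) fun i _ _ => hz.1 i)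

/-- A strictly complementary dual solution. -/
theorem exists_dual_gap (hM : IsUniqueMaxWeightMatching G w M) (ht : LPTight G w) :
    ∃ (z : V → ℝ) (ε : ℝ), DualFeasible G w z ∧ ∑ i, z i = ∑ e ∈ M, w e ∧ 0 < ε ∧
      DualGap G w M z ε := by
  classical
  -- Normals of the constraints active at the indicator of `M`: stars of matched nodes, and
  -- nonnegativity outside `M`. Their positive coefficients become the dual values and the slacks.
  let v : V ⊕ G.edgeSet → G.edgeSet → ℝ := Sum.elim
    (fun i e => if (∃ f ∈ M, i ∈ f) ∧ i ∈ (e : Sym2 V) then 1 else 0)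
    (fun f => if (f : Sym2 V) ∈ M then 0 else -Pi.single f 1)
  obtain ⟨c, hc, hcw⟩ := exists_pos_combination v (fun e => w e) (by
    intro f hf0 hf
    have hrep : ∀ y, f y = ∑ e, y e * f (Pi.single e 1) := fun y => by
      conv_lhs => rw [pi_eq_sum_univ' y]
      simp [map_sum, map_smul]
    rw [hrep]
    refine direction_value_neg hM ht (fun e => f (Pi.single e 1)) ?_ ?_ ?_
    · intro h0
      refine hf0 (ContinuousLinearMap.ext fun y => ?_)
      rw [hrep]
      refine sum_eq_zero fun e _ => ?_
      rw [show f (Pi.single e 1) = 0 from congrFun h0 e, mul_zero]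
    · intro e he
      have := hf (Sum.inr e)
      simpa [v, he] using this
    · intro i hi
      have := hf (Sum.inl i)
      rw [hrep] at this
      simpa [v, hi, sum_filter] using this)
  let z : V → ℝ := fun i => if ∃ f ∈ M, i ∈ f then c (Sum.inl i) else 0
  have hval : ∀ e : G.edgeSet, w e = ∑ i with i ∈ (e : Sym2 V), z i -
      if (e : Sym2 V) ∈ M then 0 else c (Sum.inr e) := by
    intro e
    have h1 := congrFun hcw e
    simp only [Fintype.sum_sum_type, Finset.sum_apply, Pi.smul_apply, smul_eq_mul, v,
      Sum.elim_inl, Sum.elim_inr] at h1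
    rw [← h1, sub_eq_add_neg]
    congr 1
    · rw [sum_filter]
      refine sum_congr rfl fun i _ => ?_
      simp only [z]
      split_ifs <;> simp_all
    · rw [sum_eq_single e]
      · split_ifs <;> simp
      · intro f _ hf
        split_ifs <;> simp [hf.symm]
      · simp
  have hadj : ∀ i j, (h : G.Adj i j) → w s(i, j) = z i + z j -
      if s(i, j) ∈ M then 0 else c (Sum.inr ⟨s(i, j), h⟩) := fun i j h => by
    have := hval ⟨s(i, j), h⟩
    rwa [sum_endpoints z h.ne] at this
  obtain ⟨ε, hε, hmin⟩ : ∃ ε : ℝ, 0 < ε ∧ ∀ e : G.edgeSet, ε ≤ c (Sum.inr e) := by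
    cases isEmpty_or_nonempty G.edgeSet with
    | inl h => exact ⟨1, one_pos, fun e => h.elim e⟩
    | inr h =>
      obtain ⟨e, he⟩ := Finite.exists_min fun e : G.edgeSet => c (Sum.inr e)
      exact ⟨_, hc _, he⟩
  refine ⟨z, ε, ⟨fun i => ?_, fun i j h => ?_⟩, ?_, hε, fun i j h hn => ?_⟩
  · simp only [z]; split_ifs
    · exact (hc _).le
    · exact le_rfl
  · rw [hadj i j h]
    split_ifs
    · simp
    · linarith [hc (Sum.inr ⟨s(i, j), h⟩)]
  · have h1 : ∑ e ∈ M, w e = ∑ e ∈ M, ∑ i with i ∈ e, z i := by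
      refine sum_congr rfl fun e he => ?_
      have := hval ⟨e, SimpleGraph.mem_edgeFinset.1 (hM.1.1 he)⟩
      simpa [he] using this
    rw [h1, sum_matching_endpoints hM.1, sum_filter]
    refine sum_congr rfl fun i _ => ?_
    simp only [z]
    split_ifs <;> rfl
  · rw [hadj i j h, if_neg hn]
    linarith [hmin ⟨s(i, j), h⟩]

theorem exists_dualOptimal_gap (hM : IsUniqueMaxWeightMatching G w M) (ht : LPTight G w) :
    ∃ (z : V → ℝ) (ε : ℝ), DualOptimal G w z ∧ 0 < ε ∧ DualGap G w M z ε := by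
  obtain ⟨z, ε, hz, hs, hε, hgap⟩ := exists_dual_gap hM ht
  exact ⟨z, ε, ⟨hz, fun z' hz' => hs ▸ weight_le_sum_dual hM.1 hz'⟩, hε, hgap⟩

/-- Complementary slackness for optimal dual solutions. -/
theorem complementary_slackness (hM : IsUniqueMaxWeightMatching G w M) (ht : LPTight G w)
    {z : V → ℝ} (hz : DualOptimal G w z) :
    (∀ i, (¬∃ e ∈ M, i ∈ e) → z i = 0) ∧
      ∀ i j, G.Adj i j → s(i, j) ∈ M → w s(i, j) = z i + z j := by
  -- Only strong duality is taken from `z'`; it makes every inequality in the weak duality chain for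
  -- `z` an equality.
  obtain ⟨z', ε, hz', hs, -, -⟩ := exists_dual_gap hM ht
  have htot : ∑ i, z i ≤ ∑ e ∈ M, w e := hs ▸ hz.2 z' hz'
  have hsplit := sum_filter_add_sum_filter_not univ (fun i : V => ∃ e ∈ M, i ∈ e) z
  rw [← sum_matching_endpoints hM.1] at hsplit
  have hle : ∀ e ∈ M, w e ≤ ∑ i with i ∈ e, z i := fun e he => by
    have hadj := SimpleGraph.mem_edgeFinset.1 (hM.1.1 he)
    induction e with | _ i j
    rw [SimpleGraph.mem_edgeSet] at hadj
    rw [sum_endpoints z hadj.ne]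
    exact hz.1.2 i j hadj
  have h1 := sum_le_sum hle
  have h2 : 0 ≤ ∑ i with ¬∃ e ∈ M, i ∈ e, z i := sum_nonneg fun i _ => hz.1.1 i
  constructor
  · intro i hi
    exact (sum_eq_zero_iff_of_nonneg fun i _ => hz.1.1 i).1 (by linarith) i
      (mem_filter.2 ⟨mem_univ i, hi⟩)
  · intro i j h hij
    have := (sum_eq_sum_iff_of_le hle).1 (by linarith) _ hij
    rwa [sum_endpoints z h.ne] at this

/-- Deleting the edge leaves another matching, which must be strictly lighter. -/
theorem weight_pos_of_mem (hM : IsUniqueMaxWeightMatching G w M) {e : Sym2 V} (he : e ∈ M) :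
    0 < w e := by
  have := hM.2 (M.erase e) ⟨(erase_subset _ _).trans hM.1.1, fun a ha b hb =>
    hM.1.2 a (mem_of_mem_erase ha) b (mem_of_mem_erase hb)⟩ (erase_ne_self.2 he)
  have h2 := add_sum_erase M w he
  linarith

omit [DecidableEq V] [DecidableRel G.Adj] in
theorem weight_le_maxWeight {i j : V} (h : G.Adj i j) : w s(i, j) ≤ maxWeight G w :=
  le_ciSup (f := fun e : G.edgeSet => w e) (Set.finite_range _).bddAbove ⟨s(i, j), h⟩
-- Message invariants and their propagation.
variable {z : V → ℝ} {W ε : ℝ}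

/-- A dual solution in complementary slackness with the matching `M`, with gap `ε` outside `M`, for
weights bounded by `W`. -/
structure DualCertificate (G : SimpleGraph V) [DecidableRel G.Adj] (w : Sym2 V → ℝ)
    (M : Finset (Sym2 V)) (z : V → ℝ) (W ε : ℝ) : Prop where
  matching : IsMatching G M
  nonneg : ∀ i, 0 ≤ z i
  eq_zero : ∀ i, (¬∃ e ∈ M, i ∈ e) → z i = 0
  tight : ∀ i j, G.Adj i j → s(i, j) ∈ M → w s(i, j) = z i + z j
  gap : DualGap G w M z ε
  gap_pos : 0 < ε
  weight_le : ∀ i j, G.Adj i j → w s(i, j) ≤ W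
  bound_nonneg : 0 ≤ W

omit [DecidableEq V] in
theorem DualCertificate.exists_partner (h : DualCertificate G w M z W ε) {i : V}
    (hi : ∃ e ∈ M, i ∈ e) : ∃ k, G.Adj i k ∧ s(i, k) ∈ M := by
  obtain ⟨e, he, hie⟩ := hi
  obtain ⟨k, rfl⟩ := Sym2.mem_iff_exists.1 hie
  exact ⟨k, SimpleGraph.mem_edgeFinset.1 (h.matching.1 he), he⟩

theorem DualCertificate.le_bound (h : DualCertificate G w M z W ε) (i : V) : z i ≤ W := by
  by_cases hi : ∃ e ∈ M, i ∈ e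
  · obtain ⟨k, hik, hk⟩ := h.exists_partner hi
    linarith [h.tight i k hik hk, h.weight_le i k hik, h.nonneg k]
  · rw [h.eq_zero i hi]
    exact h.bound_nonneg

/-- The bound on the log-ratio `a` of the message from factor `i` to variable `(i,j)` that is
guaranteed once the branch of this message contains the full branch of depth `d`. -/
def LogRatioBound (M : Finset (Sym2 V)) (z : V → ℝ) (W ε : ℝ) (d : ℕ) (i j : V) (a : ℝ) : Prop :=
  (s(i, j) ∈ M → a ≤ max 0 (z i + max (-ε) (W - ((d + 1) / 2 : ℕ) * ε))) ∧
    (s(i, j) ∉ M → z i - max 0 (W - (d / 2 : ℕ) * ε) ≤ a)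

/-- The invariant of a message `m` from factor `i` to variable `(i,j)` with branch `B`. -/
def ToVarInvariant (G : SimpleGraph V) [DecidableRel G.Adj] (M : Finset (Sym2 V)) (z : V → ℝ)
    (W ε : ℝ) (m : Fin 2 → ℝ) (B : Set (List V)) (i j : V) : Prop :=
  0 < m 1 ∧ ∃ a, 0 ≤ a ∧ m 0 = Real.exp a * m 1 ∧
    ∀ d, fullBranch G d i j ⊆ B → LogRatioBound M z W ε d i j a

/-- The invariant of the log-ratio `r` of a message from variable `(i,j)` to factor `i` with
branch `B`. -/
def ToFacLogRatio (G : SimpleGraph V) [DecidableRel G.Adj] (w : Sym2 V → ℝ) (M : Finset (Sym2 V))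
    (z : V → ℝ) (W ε : ℝ) (r : ℝ) (B : Set (List V)) (i j : V) : Prop :=
  (r = 0 ∧ B = ∅) ∨ ∃ a, 0 ≤ a ∧ r = w s(i, j) - a ∧
    ∀ d, fullBranch G d j i ⊆ B → LogRatioBound M z W ε d j i a

/-- The invariant of a message `m` from variable `(i,j)` to factor `i` with branch `B`. -/
def ToFacInvariant (G : SimpleGraph V) [DecidableRel G.Adj] (w : Sym2 V → ℝ) (M : Finset (Sym2 V))
    (z : V → ℝ) (W ε : ℝ) (m : Fin 2 → ℝ) (B : Set (List V)) (i j : V) : Prop :=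
  0 < m 0 ∧ ∃ r, m 1 = Real.exp r * m 0 ∧ ToFacLogRatio G w M z W ε r B i j

theorem nil_mem_fullBranch (d : ℕ) (i j : V) : [] ∈ fullBranch G (d + 1) i j := by
  cases d <;> simp [fullBranch]

theorem mem_others {i j k : V} : k ∈ others G i j ↔ k ≠ j ∧ G.Adj i k := by
  simp [others]

theorem fullBranch_subset_of_join {d : ℕ} {i j : V} {B : V → Set (List V)}
    (h : fullBranch G (d + 1) i j ⊆ {[]} ∪ ⋃ k ∈ others G i j, List.cons k '' B k) {k : V}
    (hk : k ∈ others G i j) : fullBranch G d k i ⊆ B k := by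
  cases d with
  | zero => simp [fullBranch]
  | succ d =>
    intro l hl
    have : k :: l ∈ fullBranch G (d + 1 + 1) i j :=
      Or.inr (Set.mem_iUnion₂.2 ⟨k, hk, l, hl, rfl⟩)
    rcases h this with h | h
    · simp at h
    · obtain ⟨k', -, l', hl', he⟩ := Set.mem_iUnion₂.1 h
      obtain ⟨rfl, rfl⟩ := List.cons.inj he
      exact hl'

omit [Fintype V] [DecidableEq V] in
theorem logRatioBound_zero_of_one (hε : 0 < ε) {i j : V} {a : ℝ}
    (h : LogRatioBound M z W ε 1 i j a) : LogRatioBound M z W ε 0 i j a := by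
  refine ⟨fun hm => (h.1 hm).trans ?_, fun hm => by simpa using h.2 hm⟩
  have h1 : W - ((1 + 1) / 2 : ℕ) * ε ≤ W - ((0 + 1) / 2 : ℕ) * ε := by norm_num; linarith
  exact max_le_max le_rfl (add_le_add le_rfl (max_le_max le_rfl h1))

/-- The bounds propagate through the update of a message from a factor to a variable. -/
theorem logRatioBound_fold_succ (h : DualCertificate G w M z W ε) {i j : V} (hij : G.Adj i j)
    {r : V → ℝ} {B : V → Set (List V)}
    (hr : ∀ k ∈ others G i j, ToFacLogRatio G w M z W ε (r k) (B k) i k) {d : ℕ}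
    (hd : fullBranch G (d + 1) i j ⊆ {[]} ∪ ⋃ k ∈ others G i j, List.cons k '' B k) :
    LogRatioBound M z W ε (d + 1) i j ((others G i j).fold max 0 r) := by
  have hdiv : ((d + 1 + 1) / 2 : ℕ) = d / 2 + 1 := Nat.add_div_right d two_pos
  have hsub : ∀ k ∈ others G i j, fullBranch G d k i ⊆ B k :=
    fun k hk => fullBranch_subset_of_join hd hk
  set a := (others G i j).fold max 0 r
  have ha0 : 0 ≤ a := le_fold_max (c := (0 : ℝ)) |>.2 (Or.inl le_rfl)
  refine ⟨fun hm => ?_, fun hm => ?_⟩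
  · rw [hdiv]
    refine fold_max_le (c := max 0 _) |>.2 ⟨le_max_left _ _, fun k hk => ?_⟩
    obtain ⟨hkj, hik⟩ := mem_others.1 hk
    rcases hr k hk with ⟨hr0, -⟩ | ⟨b, -, hrb, hb⟩
    · rw [hr0]
      exact le_max_left _ _
    · have hkM : s(i, k) ∉ M := fun hkM => hkj <| by
        have := h.matching.2 _ hkM _ hm i (by simp) (by simp)
        simpa [hik.ne', hij.ne'] using this
      have h1 := h.gap i k hik hkM
      have h2 := (hb d (hsub k hk)).2 (by rwa [Sym2.eq_swap])
      rw [hrb]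
      refine le_max_of_le_right ?_
      push_cast
      have h3 := le_max_left (-ε) (W - ((d / 2 : ℕ) + 1) * ε)
      have h4 := le_max_right (-ε) (W - ((d / 2 : ℕ) + 1) * ε)
      rcases max_cases 0 (W - (d / 2 : ℕ) * ε) with h5 | h5 <;> rw [h5.1] at h2 <;> linarith
  · have h0 := le_max_left 0 (W - ((d + 1) / 2 : ℕ) * ε)
    by_cases hi : ∃ e ∈ M, i ∈ e
    · obtain ⟨k, hik, hkM⟩ := h.exists_partner hi
      have hkj : k ≠ j := by rintro rfl; exact hm hkM
      have hk : k ∈ others G i j := mem_others.2 ⟨hkj, hik⟩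
      have hrk : r k ≤ a := le_fold_max (c := r k) |>.2 (Or.inr ⟨k, hk, le_rfl⟩)
      rcases hr k hk with ⟨-, hB⟩ | ⟨b, -, hrb, hb⟩
      -- The partner's message is still initial, so only depth `1` is claimed; there the error is `W
      -- ≥ z i`, and `0 ≤ a` suffices.
      · have hd0 : d = 0 := by
          by_contra hne
          obtain ⟨d, rfl⟩ := Nat.exists_eq_succ_of_ne_zero hne
          have := hsub k hk (nil_mem_fullBranch d k i)
          simp [hB] at this
        subst hd0
        have h1 := h.le_bound i
        have h2 : W ≤ max 0 (W - ((0 + 1) / 2 : ℕ) * ε) := by norm_num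
        linarith
      · have h1 := h.tight i k hik hkM
        have h2 := (hb d (hsub k hk)).1 (by rwa [Sym2.eq_swap])
        have h3 := h.nonneg k
        have hε := h.gap_pos
        have h4 := le_max_right 0 (W - ((d + 1) / 2 : ℕ) * ε)
        rcases max_cases 0 (z k + max (-ε) (W - ((d + 1) / 2 : ℕ) * ε)) with h5 | h5 <;>
          rcases max_cases (-ε) (W - ((d + 1) / 2 : ℕ) * ε) with h6 | h6 <;>
          rw [h5.1] at h2 <;> linarith
    · rw [h.eq_zero i hi]
      linarith

theorem logRatioBound_fold (h : DualCertificate G w M z W ε) {i j : V} (hij : G.Adj i j)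
    {r : V → ℝ} {B : V → Set (List V)}
    (hr : ∀ k ∈ others G i j, ToFacLogRatio G w M z W ε (r k) (B k) i k) {d : ℕ}
    (hd : fullBranch G d i j ⊆ {[]} ∪ ⋃ k ∈ others G i j, List.cons k '' B k) :
    LogRatioBound M z W ε d i j ((others G i j).fold max 0 r) := by
  cases d with
  | zero =>
    refine logRatioBound_zero_of_one h.gap_pos (logRatioBound_fold_succ h hij hr ?_)
    simp [fullBranch]
  | succ d => exact logRatioBound_fold_succ h hij hr hd

-- With `p` the product of all zero entries, the alternative with value `1` at `k` is `exp (r k) *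
-- p`; max-product thus becomes max-plus on log-ratios.
omit [Fintype V] in
theorem fold_max_exp_mul (s : Finset V) (r : V → ℝ) {p : ℝ} (hp : 0 ≤ p) :
    s.fold max p (fun k => Real.exp (r k) * p) = Real.exp (s.fold max 0 r) * p := by
  induction s using Finset.induction_on with
  | empty => simp
  | insert k s hk ih =>
    rw [fold_insert hk, fold_insert hk, ih, Real.exp_monotone.map_max, max_mul_of_nonneg _ _ hp]

theorem toVarInvariant_update (h : DualCertificate G w M z W ε) {i j : V} (hij : G.Adj i j)
    {m : Messages V} {B : V → Set (List V)}
    (hm : ∀ k ∈ others G i j, ToFacInvariant G w M z W ε (m.toFac i k) (B k) i k) :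
    ToVarInvariant G M z W ε (newToVar G m i j)
      ({[]} ∪ ⋃ k ∈ others G i j, List.cons k '' B k) i j := by
  have hex : ∀ k, k ∈ others G i j → ∃ r, m.toFac i k 1 = Real.exp r * m.toFac i k 0 ∧
      ToFacLogRatio G w M z W ε r (B k) i k := fun k hk => (hm k hk).2
  choose! r hr using hex
  have hp : 0 < ∏ k ∈ others G i j, m.toFac i k 0 := prod_pos fun k hk => (hm k hk).1
  refine ⟨by simpa [newToVar] using hp, (others G i j).fold max 0 r,
    le_fold_max (c := (0 : ℝ)) |>.2 (Or.inl le_rfl), ?_,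
    fun d hd => logRatioBound_fold h hij (fun k hk => (hr k hk).2) hd⟩
  simp only [newToVar, Matrix.cons_val_zero, Matrix.cons_val_one]
  rw [← fold_max_exp_mul _ _ hp.le]
  refine fold_congr fun k hk => ?_
  rw [(hr k hk).1, mul_assoc, mul_prod_erase _ (fun l => m.toFac i l 0) hk]

theorem toFacInvariant_update {m : Messages V} {B : Set (List V)} {i j : V}
    (hm : ToVarInvariant G M z W ε (m.toVar j i) B j i) :
    ToFacInvariant G w M z W ε (newToFac w m i j) B i j := by
  obtain ⟨hpos, a, ha, hma, hb⟩ := hm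
  refine ⟨by simp only [newToFac, Matrix.cons_val_zero, hma]; positivity, w s(i, j) - a, ?_,
    Or.inr ⟨a, ha, rfl, hb⟩⟩
  simp only [newToFac, Matrix.cons_val_zero, Matrix.cons_val_one, hma]
  rw [← mul_assoc, ← Real.exp_add, sub_add_cancel]

/-- All messages satisfy their invariants at all times. -/
theorem invariant_messages (h : DualCertificate G w M z W ε) (S : Schedule V) (t : ℕ) :
    (∀ i j, G.Adj i j → ToVarInvariant G M z W ε ((messages G w S t).toVar i j)
      ((branches G S t).toVar i j) i j) ∧
    ∀ i j, G.Adj i j → ToFacInvariant G w M z W ε ((messages G w S t).toFac i j)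
      ((branches G S t).toFac i j) i j := by
  induction t with
  | zero =>
    have hfac : ∀ i j, G.Adj i j → ToFacInvariant G w M z W ε ((messages G w S 0).toFac i j)
        ((branches G S 0).toFac i j) i j := fun i j _ =>
      ⟨by simp [messages], 0, by simp [messages], Or.inl ⟨rfl, rfl⟩⟩
    refine ⟨fun i j hij => ?_, hfac⟩
    -- The initial factor messages and branches are what an update from the initial variable
    -- messages, with empty branches, would produce.
    have hupd := toVarInvariant_update h hij (m := messages G w S 0)
      (B := (branches G S 0).toFac i) fun k hk => hfac i k (mem_others.1 hk).2
    have hmsg : newToVar G (messages G w S 0) i j = (messages G w S 0).toVar i j := by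
      have hfold : (others G i j).fold max (1 : ℝ) (fun _ => 1) = 1 :=
        le_antisymm (fold_max_le (c := (1 : ℝ)) |>.2 ⟨le_rfl, fun _ _ => le_rfl⟩)
          (le_fold_max (c := (1 : ℝ)) |>.2 (Or.inl le_rfl))
      funext x
      fin_cases x <;> simp [newToVar, messages, hfold]
    have hbr : ({[]} ∪ ⋃ k ∈ others G i j, List.cons k '' (branches G S 0).toFac i k)
        = (branches G S 0).toVar i j := by simp [branches]
    rwa [hmsg, hbr] at hupd
  | succ t ih =>
    refine ⟨fun i j hij => ?_, fun i j hij => ?_⟩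
    · simp only [messages, branches]
      split_ifs
      · exact toVarInvariant_update h hij fun k hk => ih.2 i k (mem_others.1 hk).2
      · exact ih.1 i j hij
    · simp only [messages, branches]
      split_ifs
      · exact toFacInvariant_update (ih.1 j i hij.symm)
      · exact ih.2 i j hij

/-! ### From invariants to beliefs. -/

theorem fullBranch_subset_of_fullUpTo {S : Schedule V} {t k : ℕ} {i j : V} (hij : i ≠ j)
    (h : FullUpTo G S t i j k) :
    fullBranch G k i j ⊆ (branches G S t).toVar i j ∧
      fullBranch G k j i ⊆ (branches G S t).toVar j i := by
  constructor
  · intro l hl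
    rcases h (Or.inl ⟨l, hl, rfl⟩) with ⟨l', hl', he⟩ | ⟨l', hl', he⟩
    · simp only [List.cons.injEq, true_and] at he
      exact he ▸ hl'
    · exact absurd (List.cons.inj he).1 hij
  · intro l hl
    rcases h (Or.inr ⟨l, hl, rfl⟩) with ⟨l', hl', he⟩ | ⟨l', hl', he⟩
    · exact absurd (List.cons.inj he).1 hij.symm
    · simp only [List.cons.injEq, true_and] at he
      exact he ▸ hl'

theorem convergesToBy_of_certificate (h : DualCertificate G w M z W ε)
    (hpos : ∀ e ∈ M, 0 < w e) {k : ℕ} (hk : 2 * W / ε < k) : ConvergesToBy G w M k := by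
  intro S t i j hij hfull
  have hε := h.gap_pos
  rw [div_lt_iff₀ hε] at hk
  obtain ⟨hbi, hbj⟩ := fullBranch_subset_of_fullUpTo hij.ne hfull
  obtain ⟨hmi, a, -, ha, hai⟩ := (invariant_messages h S t).1 i j hij
  obtain ⟨hmj, b, -, hb, hbj'⟩ := (invariant_messages h S t).1 j i hij.symm
  replace hai := hai k hbi
  replace hbj' := hbj' k hbj
  have hp : 0 < (messages G w S t).toVar i j 1 * (messages G w S t).toVar j i 1 := by positivity
  have h0 : belief G w S t i j 0 = Real.exp (a + b) *
      ((messages G w S t).toVar i j 1 * (messages G w S t).toVar j i 1) := by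
    simp only [belief, Matrix.cons_val_zero, ha, hb, Real.exp_add]
    ring
  have h1 : belief G w S t i j 1 = Real.exp (w s(i, j)) *
      ((messages G w S t).toVar i j 1 * (messages G w S t).toVar j i 1) := by
    simp only [belief, Matrix.cons_val_one, Matrix.cons_val_zero]
    ring
  rw [h0, h1, gt_iff_lt, mul_lt_mul_iff_left₀ hp, mul_lt_mul_iff_left₀ hp, Real.exp_lt_exp,
    Real.exp_lt_exp]
  by_cases hm : s(i, j) ∈ M
  · have hlt : a + b < w s(i, j) := by
      have hγ : max (-ε) (W - ((k + 1) / 2 : ℕ) * ε) < 0 := by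
        have h2 : (k : ℝ) ≤ 2 * ((k + 1) / 2 : ℕ) := by
          exact_mod_cast (by omega : k ≤ 2 * ((k + 1) / 2))
        have h3 := mul_le_mul_of_nonneg_right h2 hε.le
        exact max_lt (by linarith) (by linarith)
      have h2 := hai.1 hm
      have h3 := hbj'.1 (by rwa [Sym2.eq_swap])
      have h4 := h.tight i j hij hm
      have h5 := hpos _ hm
      have h6 := h.nonneg i
      have h7 := h.nonneg j
      -- If both maxima are `0`, only positivity of the matched weight gives a strict inequality.
      rcases max_cases 0 (z i + max (-ε) (W - ((k + 1) / 2 : ℕ) * ε)) with h8 | h8 <;>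
        rcases max_cases 0 (z j + max (-ε) (W - ((k + 1) / 2 : ℕ) * ε)) with h9 | h9 <;>
        linarith
    simp [hm, hlt, hlt.le]
  · have hlt : w s(i, j) < a + b := by
      -- Each endpoint may err by less than `ε / 2`, so the total stays below the gap; odd `k` costs
      -- the extra half.
      have hδ : max 0 (W - (k / 2 : ℕ) * ε) < ε / 2 := by
        have h2 : (k : ℝ) ≤ 2 * (k / 2 : ℕ) + 1 := by
          exact_mod_cast (by omega : k ≤ 2 * (k / 2) + 1)
        have h3 := mul_le_mul_of_nonneg_right h2 hε.le
        exact max_lt (by linarith) (by linarith)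
      have h2 := hai.2 hm
      have h3 := hbj'.2 (by rwa [Sym2.eq_swap])
      have h4 := h.gap i j hij hm
      linarith
    simp [hm, hlt, hlt.le]

end MaxProductMatching

open MaxProductMatching in
theorem theorem1 {V : Type*} [Fintype V] [DecidableEq V]
    (G : SimpleGraph V) [DecidableRel G.Adj]
    (w : Sym2 V → ℝ) (hw : ∀ e ∈ G.edgeSet, 0 ≤ w e)
    (M : Finset (Sym2 V)) (hM : IsUniqueMaxWeightMatching G w M)
    (htight : LPTight G w) :
    (∃ (z : V → ℝ) (ε : ℝ), DualOptimal G w z ∧ 0 < ε ∧ DualGap G w M z ε) ∧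
    ∀ (z : V → ℝ) (ε : ℝ), DualOptimal G w z → 0 < ε → DualGap G w M z ε →
      ∀ k : ℕ, 2 * maxWeight G w / ε < k → ConvergesToBy G w M k := by
  refine ⟨exists_dualOptimal_gap hM htight, fun z ε hz hε hgap k hk => ?_⟩
  obtain ⟨hzero, heq⟩ := complementary_slackness hM htight hz
  refine convergesToBy_of_certificate (z := z) ⟨hM.1, hz.1.1, hzero, heq, hgap, hε,
    fun i j hij => weight_le_maxWeight hij, ?_⟩ (fun e he => weight_pos_of_mem hM he) hk
  exact Real.iSup_nonneg fun e => hw e e.2
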